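/- In $\mathbb{C}^5\otimes\mathbb{C}^5$, with computational basis vectors $|i\rangle_A|j\rangle_B$, $0\le i,j\le 4$, consider the following 16 (unnormalized) product states: $$\begin{aligned} |\phi_{1,2}\rangle&=|0\rangle_A(|0\rangle\pm|1\rangle)_B, & |\phi_{3,4}\rangle&=|0\rangle_A(|2\rangle\pm|3\rangle)_B,\\ |\phi_{5,6}\rangle&=(|0\rangle\pm|1\rangle)_A|4\rangle_B, & |\phi_{7,8}\rangle&=(|2\rangle\pm|3\rangle)_A|4\rangle_B,\\ |\phi_{9,10}\rangle&=|4\rangle_A(|3\rangle\pm|4\rangle)_B, & |\phi_{11,12}\rangle&=|4\rangle_A(|1\rangle\pm|2\rangle)_B,\\ |\phi_{13,14}\rangle&=(|3\rangle\pm|4\rangle)_A|0\rangle_B, & |\phi_{15,16}\rangle&=(|1\rangle\pm|2\rangle)_A|0\rangle_B. \end{aligned}$$ These states are nonzero and mutually orthogonal, and the set of them is nonlocal, i.e. it cannot be perfectly distinguished by LOCC: there is no protocol of local measurements by the two parties (each measurement with finitely many outcomes, its outcome communicated to the other party, and each measurement allowed to depend on all earlier outcomes; the number of rounds is finite or infinite)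 which, for every $i\in\{1,\dots,16\}$, when run on $|\phi_i\rangle$, halts and announces $i$ with probability one. Moreover, every measurement that preserves the orthogonality of these states is trivial for either party: if $M$ is a linear operator on $\mathbb{C}^5$ (with values in any $\mathbb{C}^d$) such that the vectors $(M\otimes I)|\phi_i\rangle$, $1\le i\le 16$, are mutually orthogonal, then $M^\dagger M$ is proportional to the identity; and the same holds if the vectors $(I\otimes M)|\phi_i\rangle$ are mutually orthogonal. -/

import Mathlib

open scoped Matrix Kronecker

noncomputable section

/-- (Not necessarily normalized) pure state vectors of `ℂ^m ⊗ ℂ^n`, in coordinates with respect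
to the computational basis `|a⟩_A |b⟩_B`. -/
abbrev BiState (m n : ℕ) : Type := Fin m × Fin n → ℂ

/-- The inner product `⟨φ|ψ⟩`. -/
def overlap {m n : ℕ} (φ ψ : BiState m n) : ℂ := star φ ⬝ᵥ ψ

/-- The squared norm `⟨ψ|ψ⟩`, as a real number. -/
def sqNorm {m n : ℕ} (ψ : BiState m n) : ℝ := ∑ x, ‖ψ x‖ ^ 2

/-- The product state `|a⟩_A |b⟩_B`. -/
def prodState {m n : ℕ} (a : Fin m → ℂ) (b : Fin n → ℂ) : BiState m n :=
  fun x => a x.1 * b x.2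

/-- `(M ⊗ I) |ψ⟩`: Alice applies `M`. -/
def aliceApply {m m' n : ℕ} (M : Matrix (Fin m') (Fin m) ℂ) (ψ : BiState m n) : BiState m' n :=
  (M ⊗ₖ (1 : Matrix (Fin n) (Fin n) ℂ)) *ᵥ ψ

/-- `(I ⊗ M) |ψ⟩`: Bob applies `M`. -/
def bobApply {m n n' : ℕ} (M : Matrix (Fin n') (Fin n) ℂ) (ψ : BiState m n) : BiState m n' :=
  ((1 : Matrix (Fin m) (Fin m) ℂ) ⊗ₖ M) *ᵥ ψ

/-- What the two parties do at one point of an LOCC protocol, when Alice holds an `m`-dimensional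
and Bob an `n`-dimensional system. Either they halt and announce a guess `i : ι`, or one of them
performs a local measurement with finitely many outcomes `o`, given by measurement operators `M o`
with POVM elements `(M o)ᴴ * M o` summing to the identity (the dimension `d o` of the system after
the measurement is arbitrary), and communicates the outcome, after which they
go on at `next o`. `Node m n` is the type of points of the protocol at which the
local dimensions are `m` and `n`. -/
inductive LOCCStep (ι : Type) (Node : ℕ → ℕ → Type) (m n : ℕ) : Type
  | halt (guess : ι)
  | alice (k : ℕ) (d : Fin k → ℕ) (M : ∀ o : Fin k, Matrix (Fin (d o)) (Fin m) ℂ)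
      (complete : ∑ o, (M o)ᴴ * M o = 1) (next : ∀ o : Fin k, Node (d o) n)
  | bob (k : ℕ) (d : Fin k → ℕ) (M : ∀ o : Fin k, Matrix (Fin (d o)) (Fin n) ℂ)
      (complete : ∑ o, (M o)ᴴ * M o = 1) (next : ∀ o : Fin k, Node m (d o))

/-- A two-party LOCC protocol on `ℂ^m ⊗ ℂ^n` that announces a guess in `ι`. The number of
rounds is unrestricted: it may be bounded, depend on the outcomes, or be infinite. -/
structure LOCCProtocol (ι : Type) (m n : ℕ) where
  Node : ℕ → ℕ → Type
  step : ∀ {p q : ℕ}, Node p q → LOCCStep ι Node p q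
  root : Node m n

open Classical in
/-- The weight (the probability times `⟨ψ|ψ⟩`) with which the protocol, continued from the point `s`
in the state `ψ`, halts within `t` steps and announces the guess `i`. -/
def LOCCProtocol.weight {ι : Type} {m n : ℕ} (P : LOCCProtocol ι m n) (i : ι) :
    (t : ℕ) → {p q : ℕ} → P.Node p q → BiState p q → ℝ
  | 0, _, _, _, _ => 0
  | t + 1, _, _, s, ψ =>
    match P.step s with
    | .halt j => if j = i then sqNorm ψ else 0
    | .alice _ _ M _ next => ∑ o, P.weight i t (next o) (aliceApply (M o) ψ)
    | .bob _ _ M _ next => ∑ o, P.weight i t (next o) (bobApply (M o) ψ)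

/-- A family of states is perfectly distinguished by LOCC if there is an LOCC protocol which, run
on any state `ψ i` of the family, announces `i` with probability one. -/
def LOCCDistinguishable {ι : Type} {m n : ℕ} (ψ : ι → BiState m n) : Prop :=
  ∃ P : LOCCProtocol ι m n, ∀ i,
    Filter.Tendsto (fun t => P.weight i t P.root (ψ i)) Filter.atTop (nhds (sqNorm (ψ i)))

/-- The basis vector `|i⟩` of `ℂ^5`. -/
def ket (i : Fin 5) : Fin 5 → ℂ := Pi.single i 1

/-- The sixteen product states in `ℂ^5 ⊗ ℂ^5`. -/
def phi : Fin 16 → BiState 5 5 :=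
  ![prodState (ket 0) (ket 0 + ket 1),
    prodState (ket 0) (ket 0 - ket 1),
    prodState (ket 0) (ket 2 + ket 3),
    prodState (ket 0) (ket 2 - ket 3),
    prodState (ket 0 + ket 1) (ket 4),
    prodState (ket 0 - ket 1) (ket 4),
    prodState (ket 2 + ket 3) (ket 4),
    prodState (ket 2 - ket 3) (ket 4),
    prodState (ket 4) (ket 3 + ket 4),
    prodState (ket 4) (ket 3 - ket 4),
    prodState (ket 4) (ket 1 + ket 2),
    prodState (ket 4) (ket 1 - ket 2),
    prodState (ket 3 + ket 4) (ket 0),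
    prodState (ket 3 - ket 4) (ket 0),
    prodState (ket 1 + ket 2) (ket 0),
    prodState (ket 1 - ket 2) (ket 0)]

end

/-! Triviality of the orthogonality-preserving measurements is linear algebra. With `E = Mᴴ * M`,
two states whose factors on the other side are not orthogonal give a linear equation in the entries
of `E`. These equations kill the off-diagonal entries, and each pair `|k⟩ ± |k+1⟩` then equates
neighbouring diagonal entries.

Nonlocality follows by induction on the number of steps (`LocallyIrreducible.weight_eq_zero`). If a
protocol succeeds perfectly, so does its continuation after every outcome, and states that are
perfectly distinguished, even only in the limit, are orthogonal
(`DistinguishesAt.pairwise_overlap`). So each measurement operator preserves orthogonality and is a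
multiple of an isometry. On a branch of nonzero probability all states are still nonzero, so halting
there would be wrong for some of them. Hence no weight is ever announced, whereas success needs the
weight to tend to a positive norm. -/

theorem overlap_mulVec {p q m n : ℕ} (K : Matrix (Fin p × Fin q) (Fin m × Fin n) ℂ)
    (φ ψ : BiState m n) :
    overlap (K *ᵥ φ : BiState p q) (K *ᵥ ψ) = star φ ⬝ᵥ (Kᴴ * K) *ᵥ ψ := by
  rw [overlap, Matrix.star_mulVec, ← Matrix.dotProduct_mulVec, Matrix.mulVec_mulVec]

theorem dotProduct_kronecker_mulVec_prodState {m n : ℕ} (E : Matrix (Fin m) (Fin m) ℂ)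
    (F : Matrix (Fin n) (Fin n) ℂ) (a c : Fin m → ℂ) (b d : Fin n → ℂ) :
    star (prodState a b) ⬝ᵥ (E ⊗ₖ F) *ᵥ prodState c d
      = (star a ⬝ᵥ E *ᵥ c) * (star b ⬝ᵥ F *ᵥ d) := by
  have h : (E ⊗ₖ F) *ᵥ prodState c d = prodState (E *ᵥ c) (F *ᵥ d) := by
    ext x
    simp only [Matrix.mulVec, dotProduct, prodState, Fintype.sum_prod_type, Finset.sum_mul_sum,
      Matrix.kroneckerMap_apply]
    exact Finset.sum_congr rfl fun _ _ => Finset.sum_congr rfl fun _ _ => by ring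
  rw [h]
  simp only [dotProduct, prodState, Fintype.sum_prod_type, Finset.sum_mul_sum, Pi.star_apply,
    star_mul']
  exact Finset.sum_congr rfl fun _ _ => Finset.sum_congr rfl fun _ _ => by ring

theorem overlap_aliceApply_prodState {m n d : ℕ} (M : Matrix (Fin d) (Fin m) ℂ)
    (a c : Fin m → ℂ) (b e : Fin n → ℂ) :
    overlap (aliceApply M (prodState a b)) (aliceApply M (prodState c e))
      = (star a ⬝ᵥ (Mᴴ * M) *ᵥ c) * (star b ⬝ᵥ e) := by
  rw [aliceApply, aliceApply, overlap_mulVec, Matrix.conjTranspose_kronecker,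
    ← Matrix.mul_kronecker_mul, dotProduct_kronecker_mulVec_prodState]
  simp

theorem overlap_bobApply_prodState {m n d : ℕ} (M : Matrix (Fin d) (Fin n) ℂ)
    (a c : Fin m → ℂ) (b e : Fin n → ℂ) :
    overlap (bobApply M (prodState a b)) (bobApply M (prodState c e))
      = (star a ⬝ᵥ c) * (star b ⬝ᵥ (Mᴴ * M) *ᵥ e) := by
  rw [bobApply, bobApply, overlap_mulVec, Matrix.conjTranspose_kronecker,
    ← Matrix.mul_kronecker_mul, dotProduct_kronecker_mulVec_prodState]
  simp

/-! ### The sixteen states and their orthogonality-preserving measurements. -/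

theorem phi_ne_zero (i : Fin 16) : phi i ≠ 0 := by
  intro h
  have h' : ∀ x, phi i x = 0 := fun x => by rw [h]; rfl
  fin_cases i
  · simpa [phi, prodState, ket] using h' (0, 0)
  · simpa [phi, prodState, ket] using h' (0, 0)
  · simpa [phi, prodState, ket] using h' (0, 2)
  · simpa [phi, prodState, ket] using h' (0, 2)
  · simpa [phi, prodState, ket] using h' (0, 4)
  · simpa [phi, prodState, ket] using h' (0, 4)
  · simpa [phi, prodState, ket] using h' (2, 4)
  · simpa [phi, prodState, ket] using h' (2, 4)
  · simpa [phi, prodState, ket] using h' (4, 3)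
  · simpa [phi, prodState, ket] using h' (4, 3)
  · simpa [phi, prodState, ket] using h' (4, 1)
  · simpa [phi, prodState, ket] using h' (4, 1)
  · simpa [phi, prodState, ket] using h' (3, 0)
  · simpa [phi, prodState, ket] using h' (3, 0)
  · simpa [phi, prodState, ket] using h' (1, 0)
  · simpa [phi, prodState, ket] using h' (1, 0)

theorem overlap_prodState {m n : ℕ} (a c : Fin m → ℂ) (b d : Fin n → ℂ) :
    overlap (prodState a b) (prodState c d) = (star a ⬝ᵥ c) * (star b ⬝ᵥ d) := by
  simpa [overlap] using dotProduct_kronecker_mulVec_prodState 1 1 a c b d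

theorem pairwise_overlap_phi : Pairwise fun i j => overlap (phi i) (phi j) = 0 := by
  intro i j hij
  fin_cases i <;> fin_cases j <;> first
    | exact absurd rfl hij
    | simp [phi, overlap_prodState, ket]

theorem exists_conjTranspose_mul_self_eq_smul_one_of_aliceApply {d : ℕ}
    (M : Matrix (Fin d) (Fin 5) ℂ)
    (h : Pairwise fun i j => overlap (aliceApply M (phi i)) (aliceApply M (phi j)) = 0) :
    ∃ c : ℂ, Mᴴ * M = c • (1 : Matrix (Fin 5) (Fin 5) ℂ) := by
  have key : ∀ i j, i ≠ j → overlap (aliceApply M (phi i)) (aliceApply M (phi j)) = 0 :=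
    fun i j hij => h hij
  have h1 := key 2 10 (by decide)
  have h2 := key 10 2 (by decide)
  have h3 := key 0 14 (by decide)
  have h4 := key 0 15 (by decide)
  have h5 := key 14 0 (by decide)
  have h6 := key 15 0 (by decide)
  have h7 := key 0 12 (by decide)
  have h8 := key 12 0 (by decide)
  have h9 := key 8 6 (by decide)
  have h10 := key 8 7 (by decide)
  have h11 := key 6 8 (by decide)
  have h12 := key 7 8 (by decide)
  have h13 := key 8 4 (by decide)
  have h14 := key 4 8 (by decide)
  have h15 := key 4 6 (by decide)
  have h16 := key 4 7 (by decide)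
  have h17 := key 6 4 (by decide)
  have h18 := key 7 4 (by decide)
  have h19 := key 14 12 (by decide)
  have h20 := key 12 14 (by decide)
  have h21 := key 4 5 (by decide)
  have h22 := key 6 7 (by decide)
  have h23 := key 12 13 (by decide)
  have h24 := key 14 15 (by decide)
  simp only [phi, Matrix.cons_val, overlap_aliceApply_prodState] at *
  -- Hermitian symmetry of `E` is forgotten here, which is why off-diagonal pairs were taken in both
  -- orders.
  generalize Mᴴ * M = E at *
  simp [Matrix.mulVec_add, Matrix.mulVec_sub, ket] at *
  refine ⟨E 0 0, ?_⟩
  ext i j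
  fin_cases i <;> fin_cases j <;> simp <;> grind

theorem exists_conjTranspose_mul_self_eq_smul_one_of_bobApply {d : ℕ}
    (M : Matrix (Fin d) (Fin 5) ℂ)
    (h : Pairwise fun i j => overlap (bobApply M (phi i)) (bobApply M (phi j)) = 0) :
    ∃ c : ℂ, Mᴴ * M = c • (1 : Matrix (Fin 5) (Fin 5) ℂ) := by
  have key : ∀ i j, i ≠ j → overlap (bobApply M (phi i)) (bobApply M (phi j)) = 0 :=
    fun i j hij => h hij
  -- States 4 and 12 clear the off-diagonal entries in rows and columns 4 and 0. The pairs of `|0⟩ ±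
  -- |1⟩` with `|2⟩ ± |3⟩` and of `|3⟩ ± |4⟩` with `|1⟩ ± |2⟩` clear the rest, and the last four
  -- link the diagonal.
  have h1 := key 6 14 (by decide)
  have h2 := key 14 6 (by decide)
  have h3 := key 4 0 (by decide)
  have h4 := key 0 4 (by decide)
  have h5 := key 4 1 (by decide)
  have h6 := key 1 4 (by decide)
  have h7 := key 4 2 (by decide)
  have h8 := key 2 4 (by decide)
  have h9 := key 4 3 (by decide)
  have h10 := key 3 4 (by decide)
  have h11 := key 12 8 (by decide)
  have h12 := key 8 12 (by decide)
  have h13 := key 12 9 (by decide)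
  have h14 := key 9 12 (by decide)
  have h15 := key 12 10 (by decide)
  have h16 := key 10 12 (by decide)
  have h17 := key 12 11 (by decide)
  have h18 := key 11 12 (by decide)
  have h19 := key 0 2 (by decide)
  have h20 := key 2 0 (by decide)
  have h21 := key 0 3 (by decide)
  have h22 := key 3 0 (by decide)
  have h23 := key 1 2 (by decide)
  have h24 := key 2 1 (by decide)
  have h25 := key 1 3 (by decide)
  have h26 := key 3 1 (by decide)
  have h27 := key 8 10 (by decide)
  have h28 := key 10 8 (by decide)
  have h29 := key 8 11 (by decide)
  have h30 := key 11 8 (by decide)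
  have h31 := key 9 10 (by decide)
  have h32 := key 10 9 (by decide)
  have h33 := key 9 11 (by decide)
  have h34 := key 11 9 (by decide)
  have h35 := key 0 1 (by decide)
  have h36 := key 2 3 (by decide)
  have h37 := key 8 9 (by decide)
  have h38 := key 10 11 (by decide)
  simp only [phi, Matrix.cons_val, overlap_bobApply_prodState] at *
  generalize Mᴴ * M = E at *
  simp [Matrix.mulVec_add, Matrix.mulVec_sub, ket] at *
  refine ⟨E 0 0, ?_⟩
  ext i j
  fin_cases i <;> fin_cases j <;> simp <;> grind

/-! ### Truncated protocols as incomplete POVMs. -/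

section
open scoped ComplexOrder

theorem Matrix.PosSemidef.norm_dotProduct_mulVec_sq_le {n : Type*} [Fintype n] {E : Matrix n n ℂ}
    (hE : E.PosSemidef) (x y : n → ℂ) :
    ‖star x ⬝ᵥ E *ᵥ y‖ ^ 2 ≤ (star x ⬝ᵥ E *ᵥ x).re * (star y ⬝ᵥ E *ᵥ y).re := by
  have hs : ∀ u v : n → ℂ, star (star u ⬝ᵥ E *ᵥ v) = star v ⬝ᵥ E *ᵥ u := fun u v => by
    rw [Matrix.star_dotProduct, star_star, Matrix.star_mulVec, hE.1.eq, ← Matrix.dotProduct_mulVec]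
  -- Cauchy–Schwarz needs only a semi-inner product, so `E` may be singular.
  let c : PreInnerProductSpace.Core ℂ (n → ℂ) :=
    { inner := fun u v => star u ⬝ᵥ E *ᵥ v
      conj_inner_symm := fun u v => hs v u
      re_inner_nonneg := fun u => hE.re_dotProduct_nonneg u
      add_left := fun u v w => by simp [add_dotProduct]
      smul_left := fun u v r => by simp [smul_dotProduct] }
  have h := @InnerProductSpace.Core.inner_mul_inner_self_le ℂ (n → ℂ) _ _ _ c x y
  change ‖star x ⬝ᵥ E *ᵥ y‖ * ‖star y ⬝ᵥ E *ᵥ x‖ ≤ _ at h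
  rw [← hs x y, norm_star, ← pow_two] at h
  exact h

theorem overlap_self {m n : ℕ} (ψ : BiState m n) : overlap ψ ψ = (sqNorm ψ : ℂ) := by
  simp [overlap, sqNorm, dotProduct, Complex.conj_mul']

theorem sqNorm_nonneg {m n : ℕ} (ψ : BiState m n) : 0 ≤ sqNorm ψ :=
  Finset.sum_nonneg fun _ _ => by positivity

theorem sqNorm_eq_zero_iff {m n : ℕ} (ψ : BiState m n) : sqNorm ψ = 0 ↔ ψ = 0 := by
  rw [sqNorm, Finset.sum_eq_zero_iff_of_nonneg fun _ _ => by positivity, funext_iff]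
  simp

theorem sum_dotProduct_mulVec_conjTranspose_mul {ι m : Type*} {f : ι → Type*} [Fintype m]
    [∀ o, Fintype (f o)] (s : Finset ι)
    (K : ∀ o, Matrix (f o) m ℂ) (E : ∀ o, Matrix (f o) (f o) ℂ) (ψ : m → ℂ) :
    star ψ ⬝ᵥ (∑ o ∈ s, (K o)ᴴ * E o * K o) *ᵥ ψ
      = ∑ o ∈ s, star (K o *ᵥ ψ) ⬝ᵥ E o *ᵥ (K o *ᵥ ψ) := by
  rw [Matrix.sum_mulVec, dotProduct_sum]
  refine Finset.sum_congr rfl fun o _ => ?_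
  rw [Matrix.star_mulVec, ← Matrix.dotProduct_mulVec, Matrix.mulVec_mulVec, Matrix.mulVec_mulVec,
    Matrix.mul_assoc]

namespace LOCCProtocol

/-- `E i` are the POVM elements of the measurement whose weights are `w i`, those of the guesses
in a run of bounded length. -/
structure IsPOVM {κ : Type*} [Fintype κ] [DecidableEq κ] {ι : Type} [Fintype ι] (E : ι → Matrix κ κ ℂ)
    (w : ι → (κ → ℂ) → ℝ) : Prop where
  posSemidef : ∀ i, (E i).PosSemidef
  sum_le : (1 - ∑ i, E i).PosSemidef
  weight_eq : ∀ i ψ, w i ψ = (star ψ ⬝ᵥ E i *ᵥ ψ).re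

/-- POVM elements of the continuations pull back along `K o` as `(K o)ᴴ * E o i * K o`; by
completeness, the undecided remainder pulls back in the same way and stays positive. -/
theorem exists_isPOVM_sum {ι : Type} [Fintype ι] {κ : Type*} [Fintype κ] [DecidableEq κ]
    {k : ℕ} {f : Fin k → Type*} [∀ o, Fintype (f o)] [∀ o, DecidableEq (f o)]
    (K : ∀ o, Matrix (f o) κ ℂ) (hK : ∑ o, (K o)ᴴ * K o = 1)
    (w : ∀ o, ι → (f o → ℂ) → ℝ) (h : ∀ o, ∃ E, IsPOVM E (w o)) :
    ∃ E, IsPOVM E fun i ψ => ∑ o, w o i (K o *ᵥ ψ) := by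
  choose E hE using h
  refine ⟨fun i => ∑ o, (K o)ᴴ * E o i * K o, fun i => ?_, ?_, fun i ψ => ?_⟩
  · exact Matrix.posSemidef_sum _ fun o _ => ((hE o).posSemidef i).conjTranspose_mul_mul_same _
  · have : (1 : Matrix κ κ ℂ) - ∑ i, ∑ o, (K o)ᴴ * E o i * K o
        = ∑ o, (K o)ᴴ * (1 - ∑ i, E o i) * K o := by
      rw [← hK, Finset.sum_comm, ← Finset.sum_sub_distrib]
      refine Finset.sum_congr rfl fun o _ => ?_
      rw [Matrix.mul_sub, Matrix.sub_mul, Matrix.mul_one, Matrix.mul_sum, Matrix.sum_mul]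
    rw [this]
    exact Matrix.posSemidef_sum _ fun o _ => (hE o).sum_le.conjTranspose_mul_mul_same _
  · rw [sum_dotProduct_mulVec_conjTranspose_mul, Complex.re_sum]
    exact Finset.sum_congr rfl fun o _ => (hE o).weight_eq i _

theorem sum_kronecker_one_conjTranspose_mul {m n k : ℕ} {d : Fin k → ℕ}
    (M : ∀ o : Fin k, Matrix (Fin (d o)) (Fin m) ℂ) (hM : ∑ o, (M o)ᴴ * M o = 1) :
    ∑ o, (M o ⊗ₖ (1 : Matrix (Fin n) (Fin n) ℂ))ᴴ * (M o ⊗ₖ (1 : Matrix (Fin n) (Fin n) ℂ))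
      = 1 := by
  have : (∑ o, (M o)ᴴ * M o) ⊗ₖ (1 : Matrix (Fin n) (Fin n) ℂ)
      = ∑ o, ((M o)ᴴ * M o) ⊗ₖ (1 : Matrix (Fin n) (Fin n) ℂ) := by
    ext; simp [Matrix.sum_apply, Finset.sum_mul]
  rw [← Matrix.one_kronecker_one, ← hM, this]
  simp [Matrix.conjTranspose_kronecker, ← Matrix.mul_kronecker_mul]

theorem sum_one_kronecker_conjTranspose_mul {m n k : ℕ} {d : Fin k → ℕ}
    (M : ∀ o : Fin k, Matrix (Fin (d o)) (Fin n) ℂ) (hM : ∑ o, (M o)ᴴ * M o = 1) :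
    ∑ o, ((1 : Matrix (Fin m) (Fin m) ℂ) ⊗ₖ M o)ᴴ * ((1 : Matrix (Fin m) (Fin m) ℂ) ⊗ₖ M o)
      = 1 := by
  have : (1 : Matrix (Fin m) (Fin m) ℂ) ⊗ₖ (∑ o, (M o)ᴴ * M o)
      = ∑ o, (1 : Matrix (Fin m) (Fin m) ℂ) ⊗ₖ ((M o)ᴴ * M o) := by
    ext; simp [Matrix.sum_apply, Finset.mul_sum]
  rw [← Matrix.one_kronecker_one, ← hM, this]
  simp [Matrix.conjTranspose_kronecker, ← Matrix.mul_kronecker_mul]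

theorem exists_isPOVM_weight {ι : Type} [Fintype ι] {m n : ℕ} (P : LOCCProtocol ι m n) (t : ℕ) :
    ∀ {p q : ℕ} (s : P.Node p q), ∃ E, IsPOVM E fun i (ψ : BiState p q) => P.weight i t s ψ := by
  classical
  induction t with
  | zero =>
    intro p q s
    refine ⟨fun _ => 0, fun i => .zero, by simpa using Matrix.PosSemidef.one, fun i ψ => ?_⟩
    simp [weight]
  | succ t ih =>
    intro p q s
    cases hs : P.step s with
    | halt j =>
      refine ⟨fun i => if j = i then 1 else 0, fun i => ?_, ?_, fun i ψ => ?_⟩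
      · split_ifs
        · exact .one
        · exact .zero
      · simpa using Matrix.PosSemidef.zero
      · simp only [weight, hs]
        split_ifs
        · rw [Matrix.one_mulVec]
          exact (congrArg Complex.re (overlap_self ψ)).symm
        · simp
    | alice k d M hM next =>
      simp only [weight, hs]
      exact exists_isPOVM_sum _ (sum_kronecker_one_conjTranspose_mul M hM) _ fun o => ih (next o)
    | bob k d M hM next =>
      simp only [weight, hs]
      exact exists_isPOVM_sum _ (sum_one_kronecker_conjTranspose_mul M hM) _ fun o => ih (next o)

theorem IsPOVM.weight_nonneg {κ : Type*} [Fintype κ] [DecidableEq κ] {ι : Type} [Fintype ι]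
    {E : ι → Matrix κ κ ℂ} {w : ι → (κ → ℂ) → ℝ} (h : IsPOVM E w) (i : ι) (ψ : κ → ℂ) :
    0 ≤ w i ψ := by
  rw [h.weight_eq]
  exact (h.posSemidef i).re_dotProduct_nonneg ψ

theorem IsPOVM.sum_weight_le {κ : Type*} [Fintype κ] [DecidableEq κ] {ι : Type} [Fintype ι]
    {E : ι → Matrix κ κ ℂ} {w : ι → (κ → ℂ) → ℝ} (h : IsPOVM E w) (ψ : κ → ℂ) :
    ∑ i, w i ψ ≤ (star ψ ⬝ᵥ ψ).re := by
  have := h.sum_le.re_dotProduct_nonneg ψ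
  simp only [Matrix.sub_mulVec, Matrix.one_mulVec, dotProduct_sub, Matrix.sum_mulVec,
    dotProduct_sum, map_sub, map_sum] at this
  simp only [h.weight_eq]
  exact sub_nonneg.1 this

theorem IsPOVM.posSemidef_one_sub {κ : Type*} [Fintype κ] [DecidableEq κ] {ι : Type} [Fintype ι]
    {E : ι → Matrix κ κ ℂ} {w : ι → (κ → ℂ) → ℝ} (h : IsPOVM E w) (i : ι) :
    (1 - E i).PosSemidef := by
  classical
  have : 1 - E i = (1 - ∑ j, E j) + ∑ j ∈ Finset.univ.erase i, E j := by
    rw [← Finset.add_sum_erase _ _ (Finset.mem_univ i)]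
    abel
  rw [this]
  exact h.sum_le.add (Matrix.posSemidef_sum _ fun j _ => h.posSemidef j)

/-- Insert `E i + (1 - E i)` and apply Cauchy–Schwarz to each term: `E i` is small on `χ` because
guess `j` takes most of its weight, and `1 - E i` is small on `ψ`. The bound vanishes with the two
error probabilities, so it survives the limit of infinitely many rounds. -/
theorem IsPOVM.norm_dotProduct_le {κ : Type*} [Fintype κ] [DecidableEq κ] {ι : Type} [Fintype ι]
    {E : ι → Matrix κ κ ℂ} {w : ι → (κ → ℂ) → ℝ} (h : IsPOVM E w) {i j : ι} (hij : i ≠ j)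
    (ψ χ : κ → ℂ) :
    ‖star ψ ⬝ᵥ χ‖ ≤ √((star ψ ⬝ᵥ ψ).re * ((star χ ⬝ᵥ χ).re - w j χ))
      + √(((star ψ ⬝ᵥ ψ).re - w i ψ) * (star χ ⬝ᵥ χ).re) := by
  classical
  have hsplit : star ψ ⬝ᵥ χ = star ψ ⬝ᵥ E i *ᵥ χ + star ψ ⬝ᵥ (1 - E i) *ᵥ χ := by
    simp [Matrix.sub_mulVec]
  have hle : ∀ k φ, w k φ ≤ (star φ ⬝ᵥ φ).re := fun k φ =>
    (Finset.single_le_sum (f := fun k => w k φ) (fun l _ => h.weight_nonneg l φ)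
      (Finset.mem_univ k)).trans (h.sum_weight_le φ)
  have hpair : w i χ + w j χ ≤ (star χ ⬝ᵥ χ).re := by
    rw [← Finset.sum_pair (f := fun k => w k χ) hij]
    exact (Finset.sum_le_sum_of_subset_of_nonneg (Finset.subset_univ _)
      fun l _ _ => h.weight_nonneg l χ).trans (h.sum_weight_le χ)
  have hsub : ∀ φ, (star φ ⬝ᵥ (1 - E i) *ᵥ φ).re = (star φ ⬝ᵥ φ).re - w i φ := fun φ => by
    simp [Matrix.sub_mulVec, h.weight_eq]
  rw [hsplit]
  refine (norm_add_le _ _).trans (add_le_add (Real.le_sqrt_of_sq_le ?_) (Real.le_sqrt_of_sq_le ?_))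
  · refine ((h.posSemidef i).norm_dotProduct_mulVec_sq_le ψ χ).trans ?_
    rw [← h.weight_eq, ← h.weight_eq]
    exact mul_le_mul (hle i ψ) (by linarith) (h.weight_nonneg i χ)
      ((h.weight_nonneg i ψ).trans (hle i ψ))
  · refine ((h.posSemidef_one_sub i).norm_dotProduct_mulVec_sq_le ψ χ).trans ?_
    rw [hsub, hsub]
    exact mul_le_mul_of_nonneg_left (by linarith [h.weight_nonneg i χ])
      (by linarith [hle i ψ])

end LOCCProtocol

end

/-! ### Perfect discrimination is inherited by every branch. -/

theorem sum_sqNorm_aliceApply {m n k : ℕ} {d : Fin k → ℕ}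
    (M : ∀ o : Fin k, Matrix (Fin (d o)) (Fin m) ℂ) (hM : ∑ o, (M o)ᴴ * M o = 1)
    (ψ : BiState m n) : ∑ o, sqNorm (aliceApply (M o) ψ) = sqNorm ψ := by
  have h := sum_dotProduct_mulVec_conjTranspose_mul Finset.univ
    (fun o => M o ⊗ₖ (1 : Matrix (Fin n) (Fin n) ℂ)) (fun _ => 1) ψ
  simp only [Matrix.mul_one, Matrix.one_mulVec,
    LOCCProtocol.sum_kronecker_one_conjTranspose_mul M hM] at h
  apply Complex.ofReal_injective
  rw [Complex.ofReal_sum, ← overlap_self]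
  exact (h.trans (Finset.sum_congr rfl fun o _ => overlap_self (aliceApply (M o) ψ))).symm

theorem sum_sqNorm_bobApply {m n k : ℕ} {d : Fin k → ℕ}
    (M : ∀ o : Fin k, Matrix (Fin (d o)) (Fin n) ℂ) (hM : ∑ o, (M o)ᴴ * M o = 1)
    (ψ : BiState m n) : ∑ o, sqNorm (bobApply (M o) ψ) = sqNorm ψ := by
  have h := sum_dotProduct_mulVec_conjTranspose_mul Finset.univ
    (fun o => (1 : Matrix (Fin m) (Fin m) ℂ) ⊗ₖ M o) (fun _ => 1) ψ
  simp only [Matrix.mul_one, Matrix.one_mulVec,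
    LOCCProtocol.sum_one_kronecker_conjTranspose_mul M hM] at h
  apply Complex.ofReal_injective
  rw [Complex.ofReal_sum, ← overlap_self]
  exact (h.trans (Finset.sum_congr rfl fun o _ => overlap_self (bobApply (M o) ψ))).symm

namespace LOCCProtocol

variable {ι : Type} {m n : ℕ} (P : LOCCProtocol ι m n)

theorem weight_nonneg [Fintype ι] (i : ι) (t : ℕ) {p q : ℕ} (s : P.Node p q) (ψ : BiState p q) :
    0 ≤ P.weight i t s ψ := by
  obtain ⟨E, hE⟩ := P.exists_isPOVM_weight t s
  exact hE.weight_nonneg i ψ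

theorem weight_le_sqNorm [Fintype ι] (i : ι) (t : ℕ) {p q : ℕ} (s : P.Node p q) (ψ : BiState p q) :
    P.weight i t s ψ ≤ sqNorm ψ := by
  obtain ⟨E, hE⟩ := P.exists_isPOVM_weight t s
  have h : (star ψ ⬝ᵥ ψ).re = sqNorm ψ := congrArg Complex.re (overlap_self ψ)
  rw [← h]
  exact (Finset.single_le_sum (f := fun k => P.weight k t s ψ) (fun l _ => hE.weight_nonneg l ψ)
    (Finset.mem_univ i)).trans (hE.sum_weight_le ψ)

/-- The protocol, continued from the point `s` on any state `ψ i` of the family, announces `i`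
with probability one. -/
def DistinguishesAt {p q : ℕ} (s : P.Node p q) (ψ : ι → BiState p q) : Prop :=
  ∀ i, Filter.Tendsto (fun t => P.weight i t s (ψ i)) Filter.atTop (nhds (sqNorm (ψ i)))

variable {P}

theorem DistinguishesAt.pairwise_overlap [Fintype ι] {p q : ℕ} {s : P.Node p q} {ψ : ι → BiState p q}
    (h : P.DistinguishesAt s ψ) : Pairwise fun i j => overlap (ψ i) (ψ j) = 0 := by
  intro i j hij
  have hre : ∀ φ : BiState p q, (star φ ⬝ᵥ φ).re = sqNorm φ := fun φ =>
    congrArg Complex.re (overlap_self φ)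
  have hle : ∀ t, ‖overlap (ψ i) (ψ j)‖ ≤ √(sqNorm (ψ i) * (sqNorm (ψ j) - P.weight j t s (ψ j)))
      + √((sqNorm (ψ i) - P.weight i t s (ψ i)) * sqNorm (ψ j)) := fun t => by
    obtain ⟨E, hE⟩ := P.exists_isPOVM_weight t s
    simp only [← hre]
    exact hE.norm_dotProduct_le hij (ψ i) (ψ j)
  have hlim := (((h j).const_sub (sqNorm (ψ j))).const_mul (sqNorm (ψ i))).sqrt.add
    (((h i).const_sub (sqNorm (ψ i))).mul_const (sqNorm (ψ j))).sqrt
  simp only [sub_self, mul_zero, zero_mul, Real.sqrt_zero, add_zero] at hlim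
  exact norm_le_zero_iff.1 (ge_of_tendsto' hlim hle)

/-- The deficits `N o - f o t` are nonnegative, so each is at most their sum, which tends to zero.
-/
theorem tendsto_of_tendsto_sum {k : ℕ} {f : Fin k → ℕ → ℝ} {N : Fin k → ℝ}
    (hf : ∀ o t, f o t ≤ N o)
    (h : Filter.Tendsto (fun t => ∑ o, f o t) Filter.atTop (nhds (∑ o, N o))) (o : Fin k) :
    Filter.Tendsto (f o) Filter.atTop (nhds (N o)) := by
  have hlow : ∀ t, ∑ o, f o t - ∑ o, N o + N o ≤ f o t := fun t => by
    have := Finset.single_le_sum (f := fun o => N o - f o t)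
      (fun o _ => sub_nonneg.2 (hf o t)) (Finset.mem_univ o)
    simp only [Finset.sum_sub_distrib] at this
    linarith
  refine tendsto_of_tendsto_of_tendsto_of_le_of_le ?_ tendsto_const_nhds hlow (hf o)
  simpa using (h.sub_const (∑ o, N o)).add_const (N o)

theorem DistinguishesAt.alice [Fintype ι] {p q : ℕ} {s : P.Node p q} {ψ : ι → BiState p q}
    (h : P.DistinguishesAt s ψ) {k : ℕ} {d : Fin k → ℕ}
    {M : ∀ o : Fin k, Matrix (Fin (d o)) (Fin p) ℂ} {hM : ∑ o, (M o)ᴴ * M o = 1}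
    {next : ∀ o : Fin k, P.Node (d o) q} (hs : P.step s = .alice k d M hM next) (o : Fin k) :
    P.DistinguishesAt (next o) fun i => aliceApply (M o) (ψ i) := by
  intro i
  have hi := (Filter.tendsto_add_atTop_iff_nat 1).2 (h i)
  simp only [weight, hs] at hi
  rw [← sum_sqNorm_aliceApply M hM] at hi
  exact tendsto_of_tendsto_sum (f := fun o t => P.weight i t (next o) (aliceApply (M o) (ψ i)))
    (fun o t => P.weight_le_sqNorm i t _ _) hi o

theorem DistinguishesAt.bob [Fintype ι] {p q : ℕ} {s : P.Node p q} {ψ : ι → BiState p q}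
    (h : P.DistinguishesAt s ψ) {k : ℕ} {d : Fin k → ℕ}
    {M : ∀ o : Fin k, Matrix (Fin (d o)) (Fin q) ℂ} {hM : ∑ o, (M o)ᴴ * M o = 1}
    {next : ∀ o : Fin k, P.Node p (d o)} (hs : P.step s = .bob k d M hM next) (o : Fin k) :
    P.DistinguishesAt (next o) fun i => bobApply (M o) (ψ i) := by
  intro i
  have hi := (Filter.tendsto_add_atTop_iff_nat 1).2 (h i)
  simp only [weight, hs] at hi
  rw [← sum_sqNorm_bobApply M hM] at hi
  exact tendsto_of_tendsto_sum (f := fun o t => P.weight i t (next o) (bobApply (M o) (ψ i)))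
    (fun o t => P.weight_le_sqNorm i t _ _) hi o

theorem DistinguishesAt.sqNorm_eq_zero_of_halt {p q : ℕ} {s : P.Node p q} {ψ : ι → BiState p q}
    (h : P.DistinguishesAt s ψ) {i j : ι} (hs : P.step s = .halt j) (hij : j ≠ i) :
    sqNorm (ψ i) = 0 := by
  have hi := (Filter.tendsto_add_atTop_iff_nat 1).2 (h i)
  simp only [weight, hs, if_neg hij] at hi
  exact tendsto_nhds_unique hi tendsto_const_nhds

end LOCCProtocol

/-! ### Local irreducibility rules out LOCC discrimination. -/

theorem overlap_kronecker_mulVec {p q m n : ℕ} {A : Matrix (Fin p) (Fin m) ℂ}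
    {B : Matrix (Fin q) (Fin n) ℂ} {a b : ℂ} (hA : Aᴴ * A = a • 1) (hB : Bᴴ * B = b • 1)
    (φ ψ : BiState m n) :
    overlap ((A ⊗ₖ B) *ᵥ φ : BiState p q) ((A ⊗ₖ B) *ᵥ ψ) = a * b * overlap φ ψ := by
  rw [overlap_mulVec, Matrix.conjTranspose_kronecker, ← Matrix.mul_kronecker_mul, hA, hB]
  simp [Matrix.smul_kronecker, Matrix.kronecker_smul, Matrix.smul_mulVec, overlap, mul_assoc, mul_left_comm]

theorem aliceApply_kronecker_mulVec {p' p q m n : ℕ} (M : Matrix (Fin p') (Fin p) ℂ)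
    (A : Matrix (Fin p) (Fin m) ℂ) (B : Matrix (Fin q) (Fin n) ℂ) (φ : BiState m n) :
    aliceApply M ((A ⊗ₖ B) *ᵥ φ) = ((M * A) ⊗ₖ B) *ᵥ φ := by
  rw [aliceApply, Matrix.mulVec_mulVec, ← Matrix.mul_kronecker_mul, Matrix.one_mul]

theorem bobApply_kronecker_mulVec {q' p q m n : ℕ} (M : Matrix (Fin q') (Fin q) ℂ)
    (A : Matrix (Fin p) (Fin m) ℂ) (B : Matrix (Fin q) (Fin n) ℂ) (φ : BiState m n) :
    bobApply M ((A ⊗ₖ B) *ᵥ φ) = (A ⊗ₖ (M * B)) *ᵥ φ := by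
  rw [bobApply, Matrix.mulVec_mulVec, ← Matrix.mul_kronecker_mul, Matrix.one_mul]

theorem overlap_kronecker_mulVec_alice {p q m n : ℕ} (A : Matrix (Fin p) (Fin m) ℂ)
    {B : Matrix (Fin q) (Fin n) ℂ} {b : ℂ} (hB : Bᴴ * B = b • 1) (φ ψ : BiState m n) :
    overlap ((A ⊗ₖ B) *ᵥ φ : BiState p q) ((A ⊗ₖ B) *ᵥ ψ)
      = b * overlap (aliceApply A φ) (aliceApply A ψ) := by
  rw [aliceApply, aliceApply, overlap_mulVec, overlap_mulVec, Matrix.conjTranspose_kronecker,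
    Matrix.conjTranspose_kronecker, ← Matrix.mul_kronecker_mul, ← Matrix.mul_kronecker_mul, hB]
  simp [Matrix.kronecker_smul, Matrix.smul_mulVec]

theorem overlap_kronecker_mulVec_bob {p q m n : ℕ} {A : Matrix (Fin p) (Fin m) ℂ}
    (B : Matrix (Fin q) (Fin n) ℂ) {a : ℂ} (hA : Aᴴ * A = a • 1) (φ ψ : BiState m n) :
    overlap ((A ⊗ₖ B) *ᵥ φ : BiState p q) ((A ⊗ₖ B) *ᵥ ψ)
      = a * overlap (bobApply B φ) (bobApply B ψ) := by
  rw [bobApply, bobApply, overlap_mulVec, overlap_mulVec, Matrix.conjTranspose_kronecker,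
    Matrix.conjTranspose_kronecker, ← Matrix.mul_kronecker_mul, ← Matrix.mul_kronecker_mul, hA]
  simp [Matrix.smul_kronecker, Matrix.smul_mulVec]

/-- Every orthogonality-preserving measurement operator of either party is trivial for `φ`. -/
structure LocallyIrreducible {ι : Type} {m n : ℕ} (φ : ι → BiState m n) : Prop where
  alice : ∀ (d : ℕ) (M : Matrix (Fin d) (Fin m) ℂ),
    Pairwise (fun i j => overlap (aliceApply M (φ i)) (aliceApply M (φ j)) = 0) →
      ∃ c : ℂ, Mᴴ * M = c • (1 : Matrix (Fin m) (Fin m) ℂ)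
  bob : ∀ (d : ℕ) (M : Matrix (Fin d) (Fin n) ℂ),
    Pairwise (fun i j => overlap (bobApply M (φ i)) (bobApply M (φ j)) = 0) →
      ∃ c : ℂ, Mᴴ * M = c • (1 : Matrix (Fin n) (Fin n) ℂ)

namespace LocallyIrreducible

variable {ι : Type} [Fintype ι] [Nontrivial ι] {m n : ℕ} {φ : ι → BiState m n}

/-- As long as every local operator so far has been a multiple of an isometry, the parties have
learnt nothing, so a perfect protocol cannot have halted. -/
theorem weight_eq_zero (hφ : LocallyIrreducible φ) (h0 : ∀ i, φ i ≠ 0)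
    (P : LOCCProtocol ι m n) (t : ℕ) :
    ∀ {p q : ℕ} (s : P.Node p q) (A : Matrix (Fin p) (Fin m) ℂ) (B : Matrix (Fin q) (Fin n) ℂ)
      (a b : ℂ), Aᴴ * A = a • 1 → Bᴴ * B = b • 1 →
      P.DistinguishesAt s (fun i => (A ⊗ₖ B) *ᵥ φ i) →
      ∀ i, P.weight i t s ((A ⊗ₖ B) *ᵥ φ i) = 0 := by
  induction t with
  | zero => intros; rfl
  | succ t ih =>
    intro p q s A B a b hA hB h i
    have hnorm : ∀ k, (sqNorm ((A ⊗ₖ B) *ᵥ φ k : BiState p q) : ℂ) = a * b * sqNorm (φ k) :=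
      fun k => by rw [← overlap_self, ← overlap_self, overlap_kronecker_mulVec hA hB]
    -- If `a * b = 0`, the branch has probability zero and carries no weight; otherwise both scalars
    -- can be cancelled.
    by_cases hab : a * b = 0
    · refine le_antisymm ((P.weight_le_sqNorm _ _ _ _).trans_eq ?_) (P.weight_nonneg _ _ _ _)
      exact Complex.ofReal_eq_zero.1 ((hnorm i).trans (by rw [hab, zero_mul]))
    obtain ⟨ha, hb⟩ := mul_ne_zero_iff.1 hab
    cases hs : P.step s with
    | halt j =>
      obtain ⟨k, hk⟩ := exists_ne j
      have hzero := hnorm k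
      rw [h.sqNorm_eq_zero_of_halt hs hk.symm, Complex.ofReal_zero, eq_comm, mul_eq_zero] at hzero
      exact absurd ((sqNorm_eq_zero_iff _).1 (Complex.ofReal_eq_zero.1 (hzero.resolve_left hab)))
        (h0 k)
    | alice k d M hM next =>
      simp only [LOCCProtocol.weight, hs]
      refine Finset.sum_eq_zero fun o _ => ?_
      have ho := h.alice hs o
      simp only [aliceApply_kronecker_mulVec] at ho ⊢
      -- Irreducibility is applied to the accumulated operator `M o * A` on the original space,
      -- since the current local dimension may have changed.
      obtain ⟨c, hc⟩ := hφ.alice _ (M o * A) fun k l hkl => by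
        have hzero := ho.pairwise_overlap hkl
        exact (mul_eq_zero.1 ((overlap_kronecker_mulVec_alice _ hB _ _).symm.trans hzero)).resolve_left hb
      exact ih _ _ _ _ _ hc hB ho i
    | bob k d M hM next =>
      simp only [LOCCProtocol.weight, hs]
      refine Finset.sum_eq_zero fun o _ => ?_
      have ho := h.bob hs o
      simp only [bobApply_kronecker_mulVec] at ho ⊢
      obtain ⟨c, hc⟩ := hφ.bob _ (M o * B) fun k l hkl => by
        have hzero := ho.pairwise_overlap hkl
        exact (mul_eq_zero.1 ((overlap_kronecker_mulVec_bob _ hA _ _).symm.trans hzero)).resolve_left ha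
      exact ih _ _ _ _ _ hA hc ho i

theorem not_loccDistinguishable (hφ : LocallyIrreducible φ) (h0 : ∀ i, φ i ≠ 0) :
    ¬ LOCCDistinguishable φ := by
  rintro ⟨P, hP⟩
  obtain ⟨i, -⟩ := exists_pair_ne ι
  have hw : ∀ t, P.weight i t P.root (φ i) = 0 := fun t => by
    simpa using hφ.weight_eq_zero h0 P t P.root 1 1 1 1 (by simp) (by simp)
      (by simpa [LOCCProtocol.DistinguishesAt] using hP) i
  have hi := hP i
  simp only [hw] at hi
  exact h0 i ((sqNorm_eq_zero_iff _).1 (tendsto_nhds_unique hi tendsto_const_nhds))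

end LocallyIrreducible

theorem locallyIrreducible_phi : LocallyIrreducible phi :=
  ⟨fun _ => exists_conjTranspose_mul_self_eq_smul_one_of_aliceApply,
    fun _ => exists_conjTranspose_mul_self_eq_smul_one_of_bobApply⟩

theorem theorem3 :
    -- the states are nonzero and mutually orthogonal
    ((∀ i, phi i ≠ 0) ∧ Pairwise (fun i j => overlap (phi i) (phi j) = 0)) ∧
    -- the set is nonlocal
    ¬ LOCCDistinguishable phi ∧
    -- every orthogonality-preserving measurement operator of Alice is trivial
    (∀ (d : ℕ) (M : Matrix (Fin d) (Fin 5) ℂ),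
      Pairwise (fun i j => overlap (aliceApply M (phi i)) (aliceApply M (phi j)) = 0) →
        ∃ c : ℂ, Mᴴ * M = c • (1 : Matrix (Fin 5) (Fin 5) ℂ)) ∧
    -- every orthogonality-preserving measurement operator of Bob is trivial
    (∀ (d : ℕ) (M : Matrix (Fin d) (Fin 5) ℂ),
      Pairwise (fun i j => overlap (bobApply M (phi i)) (bobApply M (phi j)) = 0) →
        ∃ c : ℂ, Mᴴ * M = c • (1 : Matrix (Fin 5) (Fin 5) ℂ)) := by
  exact ⟨⟨phi_ne_zero, pairwise_overlap_phi⟩,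
    locallyIrreducible_phi.not_loccDistinguishable phi_ne_zero,
    locallyIrreducible_phi.alice, locallyIrreducible_phi.bob⟩
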